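/- Let $Z, Y$ be real Hilbert spaces, let $X\subset Z$ be any subset and let $v\colon X\to Y$ be any map. A map $u$ from a subset of $Z$ to $Y$ is called $1$-Lipschitz if $\|u(x)-u(y)\|\le\|x-y\|$ for all $x,y$ in its domain. Consider the following conditions. (i) For all finite $m\le \dim Y$, all $x,x_1,\dots,x_m\in X$ and all non-negative real numbers $t_1,\dots,t_m$ that sum up to one, $$\Big\| v(x)-\sum_{i=1}^m t_i v(x_i)\Big\|\le \Big\| x-\sum_{i=1}^m t_i x_i\Big\| .$$ (ii) For any non-empty, closed, convex set $K\subset Y$, any $A\subset X$ and any $1$-Lipschitz map $u\colon A\to Y$ such that $u(x)-v(x)\in K$ for all $x\in A$, there exists a $1$-Lipschitz map $\tilde u\colon X\to Y$ extending $u$ such that $\tilde u(x)-v(x)\in K$ for all $x\in X$. (iii) For any $A\subset X$, any $\delta\ge 0$ and any $1$-Lipschitz map $u\colon A\to Y$ such that $\|u(x)-v(x)\|\le\delta$ for all $x\in A$, there exists a $1$-Lipschitz map $\tilde u\colon X\to Y$ extending $u$ such that $\|\tilde u(x)-v(x)\|\le\delta$ for all $x\in X$. Then (i) implies (ii), and (ii)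 implies (iii). Moreover, if either $\dim Y\in\{1,2,3\}$ or $X$ is convex, then (iii) implies (i), so that the conditions (i), (ii) and (iii) are equivalent. -/

import Mathlib

open scoped BigOperators

/-- Condition (i): for every finite `m ≤ dim Y`, the distance of `v x` to a convex combination of
`m` values of `v` is at most the distance of `x` to the same convex combination of the points. -/
def ConvexCombinationCondition {Z Y : Type*}
    [NormedAddCommGroup Z] [InnerProductSpace ℝ Z]
    [NormedAddCommGroup Y] [InnerProductSpace ℝ Y]
    (X : Set Z) (v : X → Y) : Prop :=
  ∀ m : ℕ, (m : Cardinal) ≤ Module.rank ℝ Y →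
    ∀ (x : X) (p : Fin m → X) (t : Fin m → ℝ), (∀ i, 0 ≤ t i) → ∑ i, t i = 1 →
      ‖v x - ∑ i, t i • v (p i)‖ ≤ ‖(x : Z) - ∑ i, t i • (p i : Z)‖

/-- Condition (ii): for every nonempty closed convex `K ⊆ Y` and every `A ⊆ X`, each 1-Lipschitz
`u : A → Y` with `u - v ∈ K` on `A` has a 1-Lipschitz extension to `X` with difference in `K`. -/
def ConvexSetExtensionCondition {Z Y : Type*}
    [NormedAddCommGroup Z] [InnerProductSpace ℝ Z]
    [NormedAddCommGroup Y] [InnerProductSpace ℝ Y]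
    (X : Set Z) (v : X → Y) : Prop :=
  ∀ K : Set Y, K.Nonempty → IsClosed K → Convex ℝ K →
    ∀ (A : Set X) (u : A → Y), LipschitzWith 1 u → (∀ a : A, u a - v a ∈ K) →
      ∃ u' : X → Y, LipschitzWith 1 u' ∧ (∀ a : A, u' a = u a) ∧ ∀ x : X, u' x - v x ∈ K

/-- Condition (iii): for every `δ ≥ 0` and every `A ⊆ X`, each 1-Lipschitz `u : A → Y` within
`δ` of `v` on `A` has a 1-Lipschitz extension to `X` within `δ` of `v` on `X`. -/
def BallExtensionCondition {Z Y : Type*}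
    [NormedAddCommGroup Z] [InnerProductSpace ℝ Z]
    [NormedAddCommGroup Y] [InnerProductSpace ℝ Y]
    (X : Set Z) (v : X → Y) : Prop :=
  ∀ (A : Set X) (δ : ℝ), 0 ≤ δ →
    ∀ u : A → Y, LipschitzWith 1 u → (∀ a : A, ‖u a - v a‖ ≤ δ) →
      ∃ u' : X → Y, LipschitzWith 1 u' ∧ (∀ a : A, u' a = u a) ∧ ∀ x : X, ‖u' x - v x‖ ≤ δ

/-! ### Separation and the variance identity. -/

section Minimax

variable {Y : Type*} [NormedAddCommGroup Y] [InnerProductSpace ℝ Y]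

/-! (i) ⇒ (ii): Zorn and weak compactness reduce to one new point `x` and finitely many constraints:
`v x + K` must meet slightly enlarged balls about `q i = u (p i)`. By Hahn–Banach it suffices to
treat each weighted average of the squared inequalities. The variance identity then asks only for a
point of `v x + K` within `‖x - ∑ t i • p i‖` of `∑ t i • q i`, and (i) makes `v x + ∑ t i • (q i -
v (p i))` one. In finite dimension Helly bounds the number of balls by `dim Y`.

(iii) ⇒ (i): fix a unit vector `e`. Place an isometric copy `a` of the points `p` in `Y` with the
same `e`-components as `v ∘ p`, and shift it by `-s • e`. As `s → ∞` the ball constraint tends to a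
half-space constraint, and extending to `x` bounds the `e`-component of `v x - ∑ t i • v (p i)`
(`BallExtensionCondition.inner_le`). The copy exists if `v` does not increase norms of zero-sum
combinations. For at most three points this follows from the bound with one point fewer; for convex
`X` the bounds for one and two points already give all others. -/

lemma convexOn_univ_norm_sub_sq (c : Y) : ConvexOn ℝ Set.univ fun y : Y => ‖y - c‖ ^ 2 := by
  have h := (convexOn_univ_norm (E := Y)).pow (fun _ _ => norm_nonneg _) 2
  simpa [Function.comp_def, sub_eq_add_neg, add_comm] using h.translate_left (-c)

/-- If no such point exists, the negative orthant is disjoint from the convex, upward closed set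
`T`; the coefficients of a separating functional, normalised, contradict `h`. -/
lemma exists_mem_forall_norm_sub_sq_le {ι : Type*} [Fintype ι] {C : Set Y} (hC : Convex ℝ C)
    (hne : C.Nonempty) (c : ι → Y) (ρ : ι → ℝ)
    (h : ∀ t : ι → ℝ, (∀ i, 0 ≤ t i) → ∑ i, t i = 1 →
      ∃ z ∈ C, ∑ i, t i * ‖z - c i‖ ^ 2 < ∑ i, t i * ρ i) :
    ∃ y ∈ C, ∀ i, ‖y - c i‖ ^ 2 ≤ ρ i := by
  classical
  by_contra! hcon
  let s : Set (ι → ℝ) := {w | ∀ i, w i < 0}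
  let T : Set (ι → ℝ) := {w | ∃ y ∈ C, ∀ i, ‖y - c i‖ ^ 2 - ρ i ≤ w i}
  have hs : Convex ℝ s := by
    intro x hx y hy a b ha hb hab i
    exact (convex_Iio (0 : ℝ)) (hx i) (hy i) ha hb hab
  have hso : IsOpen s := by
    simp only [s, Set.ofPred_forall]
    exact isOpen_iInter_of_finite fun i => isOpen_lt (continuous_apply i) continuous_const
  have hT : Convex ℝ T := by
    rintro x ⟨y, hy, hyx⟩ x' ⟨y', hy', hyx'⟩ a b ha hb hab
    refine ⟨a • y + b • y', hC hy hy' ha hb hab, fun i => ?_⟩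
    have h1 := (convexOn_univ_norm_sub_sq (c i)).2 (Set.mem_univ y) (Set.mem_univ y') ha hb hab
    have h2 := mul_le_mul_of_nonneg_left (hyx i) ha
    have h3 := mul_le_mul_of_nonneg_left (hyx' i) hb
    have h4 : ρ i = a * ρ i + b * ρ i := by rw [← add_mul, hab, one_mul]
    simp only [smul_eq_mul, Pi.add_apply, Pi.smul_apply] at h1 ⊢
    linarith
  have hdisj : Disjoint s T := by
    rw [Set.disjoint_left]
    rintro w hw ⟨y, hy, hyw⟩
    obtain ⟨i, hi⟩ := hcon y hy
    have := hw i
    have := hyw i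
    linarith
  obtain ⟨f, r, hf, hr⟩ := geometric_hahn_banach_open hs hso hT hdisj
  set t : ι → ℝ := fun i => f (Pi.single i 1) with ht
  have hft : ∀ w, f w = ∑ i, t i * w i := by
    intro w
    conv_lhs => rw [pi_eq_sum_univ' w]
    simp [ht, map_sum, mul_comm]
  have hr0 : 0 ≤ r := by
    by_contra! hneg
    set S := ∑ i, t i
    -- A constant vector so small that, whatever the sign of `S`, its value is at least `r / 2`.
    have h1 := hf (fun _ => -(-r / (2 * (|S| + 1)))) (fun i => by
      have : 0 < -r / (2 * (|S| + 1)) := by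
        apply div_pos <;> [linarith; positivity]
      linarith)
    rw [hft, ← Finset.sum_mul] at h1
    have h2 : S * -(-r / (2 * (|S| + 1))) = r * (S / (2 * (|S| + 1))) := by ring
    have h3 : S / (2 * (|S| + 1)) ≤ 1 := by
      rw [div_le_one (by positivity)]
      linarith [le_abs_self S, abs_nonneg S]
    change S * _ < r at h1
    rw [h2] at h1
    nlinarith
  have ht0 : ∀ i, 0 ≤ t i := by
    intro i
    by_contra! hneg
    obtain ⟨y, hy⟩ := hne
    let b : ι → ℝ := fun j => ‖y - c j‖ ^ 2 - ρ j
    -- Raising coordinate `i` by `k` stays in `T` but brings the functional below zero.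
    set k : ℝ := (|f b| + 1) / (-t i) with hk
    have hk0 : 0 ≤ k := div_nonneg (by positivity) (by linarith)
    have h1 := hr (b + k • Pi.single i 1) ⟨y, hy, fun j => by
      have : 0 ≤ (k • (Pi.single i 1 : ι → ℝ)) j := by
        by_cases hj : j = i
        · subst hj; simpa
        · simp [hj]
      simpa [b] using this⟩
    rw [map_add, map_smul] at h1
    have h2 : k • f (Pi.single i 1) = -(|f b| + 1) := by
      change k * t i = _
      rw [hk, div_neg, neg_mul, div_mul_cancel₀ _ hneg.ne]
    rw [h2] at h1
    linarith [le_abs_self (f b)]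
  have hS : 0 < ∑ i, t i := by
    refine lt_of_le_of_ne (Finset.sum_nonneg fun i _ => ht0 i) fun h0 => ?_
    have hz := (Finset.sum_eq_zero_iff_of_nonneg fun i _ => ht0 i).1 h0.symm
    have hf0 : ∀ w, f w = 0 := fun w => by
      rw [hft]; exact Finset.sum_eq_zero fun i hi => by rw [hz i hi, zero_mul]
    obtain ⟨y, hy⟩ := hne
    have h1 := hf (fun _ => -1) (fun _ => by norm_num)
    have h2 := hr (fun j => ‖y - c j‖ ^ 2 - ρ j) ⟨y, hy, fun _ => le_rfl⟩
    rw [hf0] at h1 h2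
    linarith
  obtain ⟨z, hz, hlt⟩ := h (fun i => t i / ∑ j, t j) (fun i => div_nonneg (ht0 i) hS.le)
    (by rw [← Finset.sum_div, div_self hS.ne'])
  have h2 := hr (fun j => ‖z - c j‖ ^ 2 - ρ j) ⟨z, hz, fun _ => le_rfl⟩
  rw [hft] at h2
  simp only [div_mul_eq_mul_div, ← Finset.sum_div] at hlt
  rw [div_lt_div_iff_of_pos_right hS] at hlt
  simp only [mul_sub, Finset.sum_sub_distrib] at h2
  linarith

lemma sum_mul_norm_sub_sq {ι : Type*} [Fintype ι] (t : ι → ℝ) (ht : ∑ i, t i = 1) (z : Y)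
    (c : ι → Y) :
    ∑ i, t i * ‖z - c i‖ ^ 2 =
      ‖z - ∑ i, t i • c i‖ ^ 2 + (∑ i, ∑ j, t i * t j * ‖c i - c j‖ ^ 2) / 2 := by
  have h1 : z - ∑ i, t i • c i = ∑ i, t i • (z - c i) := by
    simp only [smul_sub, Finset.sum_sub_distrib, ← Finset.sum_smul, ht, one_smul]
  have h2 : ∀ i j, ‖c i - c j‖ ^ 2 =
      ‖z - c i‖ ^ 2 + ‖z - c j‖ ^ 2 - 2 * inner ℝ (z - c i) (z - c j) := by
    intro i j
    rw [show c i - c j = (z - c j) - (z - c i) by abel, norm_sub_sq_real, real_inner_comm]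
    ring
  have h3 : ‖∑ i, t i • (z - c i)‖ ^ 2 = ∑ i, ∑ j, t i * t j * inner ℝ (z - c i) (z - c j) := by
    rw [← real_inner_self_eq_norm_sq, sum_inner]
    simp only [inner_sum, real_inner_smul_left, real_inner_smul_right, mul_assoc]
    exact Finset.sum_congr rfl fun i _ => Finset.sum_congr rfl fun j _ => by ring
  have h4 : ∑ i, ∑ j, t i * t j * ‖z - c i‖ ^ 2 = ∑ i, t i * ‖z - c i‖ ^ 2 := by
    refine Finset.sum_congr rfl fun i _ => ?_
    rw [← Finset.sum_mul, ← Finset.mul_sum, ht, mul_one]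
  have h5 : ∑ i, ∑ j, t i * t j * ‖z - c j‖ ^ 2 = ∑ i, t i * ‖z - c i‖ ^ 2 := by
    rw [Finset.sum_comm, ← h4]
    exact Finset.sum_congr rfl fun i _ => Finset.sum_congr rfl fun j _ => by ring
  have h6 : ∑ i, ∑ j, t i * t j * ‖c i - c j‖ ^ 2 =
      ∑ i, ∑ j, t i * t j * ‖z - c i‖ ^ 2 + ∑ i, ∑ j, t i * t j * ‖z - c j‖ ^ 2
        - 2 * ∑ i, ∑ j, t i * t j * inner ℝ (z - c i) (z - c j) := by
    simp only [Finset.mul_sum, ← Finset.sum_add_distrib, ← Finset.sum_sub_distrib, h2]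
    exact Finset.sum_congr rfl fun i _ => Finset.sum_congr rfl fun j _ => by ring
  rw [h1, h3, h6, h4, h5]
  ring

/-- In the variance identity the double sum depends only on mutual distances, which `hpq` compares.
The slack `ε` gives the strict inequality needed, as `C` need be neither closed nor bounded. -/
lemma exists_mem_forall_norm_sub_sq_le_add {Z : Type*} [NormedAddCommGroup Z]
    [InnerProductSpace ℝ Z] {ι : Type*} [Fintype ι] {C : Set Y} (hC : Convex ℝ C)
    (hne : C.Nonempty) (p : ι → Z) (q : ι → Y) (hpq : ∀ i j, ‖q i - q j‖ ≤ ‖p i - p j‖) (x : Z)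
    (ε : ι → ℝ) (hε : ∀ i, 0 < ε i)
    (h : ∀ t : ι → ℝ, (∀ i, 0 ≤ t i) → ∑ i, t i = 1 →
      ∃ z ∈ C, ‖z - ∑ i, t i • q i‖ ≤ ‖x - ∑ i, t i • p i‖) :
    ∃ y ∈ C, ∀ i, ‖y - q i‖ ^ 2 ≤ ‖x - p i‖ ^ 2 + ε i := by
  refine exists_mem_forall_norm_sub_sq_le hC hne q _ fun t ht0 ht1 => ?_
  obtain ⟨z, hz, hle⟩ := h t ht0 ht1
  refine ⟨z, hz, ?_⟩
  have h1 : 0 < ∑ i, t i * ε i := by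
    refine lt_of_le_of_ne (Finset.sum_nonneg fun i _ => mul_nonneg (ht0 i) (hε i).le) fun h0 => ?_
    have hz := (Finset.sum_eq_zero_iff_of_nonneg
      fun i _ => mul_nonneg (ht0 i) (hε i).le).1 h0.symm
    have : ∑ i, t i = 0 := Finset.sum_eq_zero fun i hi =>
      (mul_eq_zero.1 (hz i hi)).resolve_right (hε i).ne'
    linarith
  simp only [mul_add, Finset.sum_add_distrib]
  rw [sum_mul_norm_sub_sq t ht1, sum_mul_norm_sub_sq t ht1]
  have h2 : ∑ i, ∑ j, t i * t j * ‖q i - q j‖ ^ 2 ≤ ∑ i, ∑ j, t i * t j * ‖p i - p j‖ ^ 2 := by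
    gcongr with i _ j _
    · exact mul_nonneg (ht0 i) (ht0 j)
    · exact hpq i j
  have h3 : ‖z - ∑ i, t i • q i‖ ^ 2 ≤ ‖x - ∑ i, t i • p i‖ ^ 2 := by gcongr
  linarith

end Minimax

/-! ### Weak compactness in Hilbert space. -/

section WeakCompactness

variable {Y : Type*} [NormedAddCommGroup Y] [InnerProductSpace ℝ Y] [CompleteSpace Y]

/-- A point outside `C` is strictly separated from it by an open half-space, which is weak-* open
after Riesz identification. -/
lemma isClosed_weakDual_of_isClosed_of_convex {C : Set Y} (hcl : IsClosed C) (hC : Convex ℝ C) :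
    IsClosed {φ : WeakDual ℝ Y |
      (InnerProductSpace.toDual ℝ Y).symm (WeakDual.toStrongDual φ) ∈ C} := by
  rw [← isOpen_compl_iff, isOpen_iff_forall_mem_open]
  intro φ hφ
  obtain ⟨f, r, hlt, hr⟩ := geometric_hahn_banach_closed_point hC hcl hφ
  have hf : ∀ ψ : WeakDual ℝ Y,
      f ((InnerProductSpace.toDual ℝ Y).symm (WeakDual.toStrongDual ψ)) =
        ψ ((InnerProductSpace.toDual ℝ Y).symm f) := by
    intro ψ
    rw [← InnerProductSpace.toDual_symm_apply, real_inner_comm,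
      InnerProductSpace.toDual_symm_apply]
    rfl
  refine ⟨{ψ | r < ψ ((InnerProductSpace.toDual ℝ Y).symm f)}, fun ψ hψ hmem => ?_,
    isOpen_lt continuous_const (WeakDual.eval_continuous _), ?_⟩
  · have := hlt _ hmem
    rw [hf] at this
    exact lt_asymm this hψ
  · rw [hf] at hr
    exact hr

lemma iInter_nonempty_of_isClosed_of_convex {ι : Type*} [Nonempty ι] (F : ι → Set Y)
    (hcl : ∀ i, IsClosed (F i)) (hF : ∀ i, Convex ℝ (F i))
    (hb : ∃ i, Bornology.IsBounded (F i))
    (hfin : ∀ s : Finset ι, (⋂ i ∈ s, F i).Nonempty) : (⋂ i, F i).Nonempty := by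
  classical
  obtain ⟨i₀, hi₀⟩ := hb
  obtain ⟨R, hR⟩ := hi₀.subset_closedBall 0
  let e := InnerProductSpace.toDual ℝ Y
  obtain ⟨φ, -, hφ⟩ := (WeakDual.isCompact_closedBall (𝕜 := ℝ) (E := Y) 0 R).inter_iInter_nonempty
    (fun i => {φ : WeakDual ℝ Y | e.symm (WeakDual.toStrongDual φ) ∈ F i})
    (fun i => isClosed_weakDual_of_isClosed_of_convex (hcl i) (hF i)) (fun s => by
      obtain ⟨y, hy⟩ := hfin (insert i₀ s)
      simp only [Set.mem_iInter, Finset.mem_insert] at hy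
      refine ⟨StrongDual.toWeakDual (e y), ?_, ?_⟩
      · have := hR (hy i₀ (Or.inl rfl))
        simp only [Set.mem_preimage, Metric.mem_closedBall, dist_zero_right] at this ⊢
        simpa [e] using this
      · simp only [Set.mem_iInter, Set.mem_ofPred_eq]
        intro i hi
        simpa using hy i (Or.inr hi))
  exact ⟨e.symm (WeakDual.toStrongDual φ), by simpa using hφ⟩

end WeakCompactness

/-! ### From (i) to (ii) and (iii). -/

section Extension

variable {Z Y : Type*} [NormedAddCommGroup Z] [InnerProductSpace ℝ Z]
  [NormedAddCommGroup Y] [InnerProductSpace ℝ Y] {X : Set Z} {v : X → Y}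

lemma ConvexCombinationCondition.norm_sub_le (h : ConvexCombinationCondition X v) {ι : Type*}
    [Fintype ι] (hι : (Fintype.card ι : Cardinal) ≤ Module.rank ℝ Y) (x : X) (p : ι → X)
    (t : ι → ℝ) (ht0 : ∀ i, 0 ≤ t i) (ht1 : ∑ i, t i = 1) :
    ‖v x - ∑ i, t i • v (p i)‖ ≤ ‖(x : Z) - ∑ i, t i • (p i : Z)‖ := by
  let e := (Fintype.equivFin ι).symm
  have := h _ hι x (p ∘ e) (t ∘ e) (fun i => ht0 _) (by rw [← ht1]; exact e.sum_comp t)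
  simpa only [Function.comp_apply, e.sum_comp (fun i => t i • v (p i)),
    e.sum_comp (fun i => t i • (p i : Z))] using this

lemma convex_setOf_sub_mem {K : Set Y} (hK : Convex ℝ K) (w : Y) :
    Convex ℝ {y | y - w ∈ K} := by
  simp only [sub_eq_add_neg]
  exact hK.translate_preimage_left (-w)

lemma convex_setOf_norm_sub_sq_le (c : Y) (r : ℝ) : Convex ℝ {y : Y | ‖y - c‖ ^ 2 ≤ r} := by
  simpa using (convexOn_univ_norm_sub_sq c).convex_le r

lemma ConvexCombinationCondition.exists_finite_extension_of_card_le
    (h : ConvexCombinationCondition X v) {K : Set Y} (hne : K.Nonempty) (hK : Convex ℝ K)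
    {ι : Type*} [Fintype ι] (hι : (Fintype.card ι : Cardinal) ≤ Module.rank ℝ Y)
    (p : ι → X) (q : ι → Y) (hq : ∀ i, q i - v (p i) ∈ K)
    (hpq : ∀ i j, ‖q i - q j‖ ≤ ‖(p i : Z) - p j‖) (x : X) (ε : ι → ℝ) (hε : ∀ i, 0 < ε i) :
    ∃ y, y - v x ∈ K ∧ ∀ i, ‖y - q i‖ ^ 2 ≤ ‖(x : Z) - p i‖ ^ 2 + ε i := by
  obtain ⟨k, hk⟩ := hne
  refine exists_mem_forall_norm_sub_sq_le_add (convex_setOf_sub_mem hK (v x))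
    ⟨k + v x, by simpa⟩ (fun i => (p i : Z)) q hpq x ε hε fun t ht0 ht1 => ?_
  refine ⟨v x + ∑ i, t i • (q i - v (p i)), ?_, ?_⟩
  · simpa using hK.sum_mem (fun i _ => ht0 i) ht1 (fun i _ => hq i)
  · have := h.norm_sub_le hι x p t ht0 ht1
    simp only [smul_sub, Finset.sum_sub_distrib]
    convert this using 2
    abel

/-- Helly removes the bound on the number of balls. In infinite dimension the bound is vacuous. -/
lemma ConvexCombinationCondition.exists_finite_extension
    (h : ConvexCombinationCondition X v) {K : Set Y} (hne : K.Nonempty) (hK : Convex ℝ K)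
    {ι : Type*} [Fintype ι] (p : ι → X) (q : ι → Y) (hq : ∀ i, q i - v (p i) ∈ K)
    (hpq : ∀ i j, ‖q i - q j‖ ≤ ‖(p i : Z) - p j‖) (x : X) (ε : ι → ℝ) (hε : ∀ i, 0 < ε i) :
    ∃ y, y - v x ∈ K ∧ ∀ i, ‖y - q i‖ ^ 2 ≤ ‖(x : Z) - p i‖ ^ 2 + ε i := by
  classical
  by_cases hfd : FiniteDimensional ℝ Y
  · let F : Option ι → Set Y := fun o => o.elim {y | y - v x ∈ K}
      fun i => {y | ‖y - q i‖ ^ 2 ≤ ‖(x : Z) - p i‖ ^ 2 + ε i}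
    obtain ⟨y, hy⟩ := Convex.helly_theorem' (𝕜 := ℝ) (F := F) (s := Finset.univ)
      (fun o _ => by
        cases o with
        | none => exact convex_setOf_sub_mem hK (v x)
        | some i => exact convex_setOf_norm_sub_sq_le _ _)
      (fun I _ hI => by
        by_cases hn : none ∈ I
        · obtain ⟨y, hy, hyi⟩ := h.exists_finite_extension_of_card_le hne hK
            (ι := Finset.eraseNone I) (by
              -- Of at most `dim Y + 1` sets one is `v x + K`, leaving at most `dim Y` balls.
              rw [← Module.finrank_eq_rank, Fintype.card_coe, Nat.cast_le]
              have := Finset.card_eraseNone_of_mem hn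
              omega)
            (fun i => p i) (fun i => q i) (fun i => hq i) (fun i j => hpq i j) x
            (fun i => ε i) (fun i => hε i)
          refine ⟨y, ?_⟩
          simp only [Set.mem_iInter]
          intro o ho
          cases o with
          | none => exact hy
          | some i => exact hyi ⟨i, by simpa using ho⟩
        -- Without `K` this is Kirszbraun's case: the barycentre itself serves as the witness.
        · obtain ⟨y, -, hy⟩ := exists_mem_forall_norm_sub_sq_le_add convex_univ Set.univ_nonempty
            (fun i => (p i : Z)) q hpq x ε hε fun t _ _ => ⟨_, Set.mem_univ (∑ i, t i • q i), by
              simp⟩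
          refine ⟨y, ?_⟩
          simp only [Set.mem_iInter]
          intro o ho
          cases o with
          | none => exact absurd ho hn
          | some i => exact hy i)
    simp only [Set.mem_iInter, Finset.mem_univ, true_imp_iff] at hy
    exact ⟨y, hy none, fun i => hy (some i)⟩
  · refine h.exists_finite_extension_of_card_le hne hK ?_ p q hq hpq x ε hε
    refine (Cardinal.natCast_lt_aleph0).le.trans ?_
    rw [← not_lt, Module.rank_lt_aleph0_iff]
    exact hfd

lemma ConvexCombinationCondition.exists_one_point_extension [CompleteSpace Y]
    (h : ConvexCombinationCondition X v) {K : Set Y} (hne : K.Nonempty) (hcl : IsClosed K)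
    (hK : Convex ℝ K) (G : Set (X × Y)) (hG : ∀ g ∈ G, g.2 - v g.1 ∈ K)
    (hG' : ∀ g ∈ G, ∀ g' ∈ G, ‖g.2 - g'.2‖ ≤ ‖(g.1 : Z) - g'.1‖) (x : X) :
    ∃ y, y - v x ∈ K ∧ ∀ g ∈ G, ‖y - g.2‖ ≤ ‖(x : Z) - g.1‖ := by
  obtain rfl | ⟨g₀, hg₀⟩ := G.eq_empty_or_nonempty
  · obtain ⟨k, hk⟩ := hne
    exact ⟨k + v x, by simpa, by simp⟩
  -- Indexing by the slack as well makes it disappear in the full intersection.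
  let F : G × Set.Ioi (0 : ℝ) → Set Y := fun j =>
    {y | y - v x ∈ K} ∩ {y | ‖y - j.1.1.2‖ ^ 2 ≤ ‖(x : Z) - j.1.1.1‖ ^ 2 + j.2}
  let j₀ : G × Set.Ioi (0 : ℝ) := (⟨g₀, hg₀⟩, ⟨1, Set.mem_Ioi.2 one_pos⟩)
  have : Nonempty (G × Set.Ioi (0 : ℝ)) := ⟨j₀⟩
  obtain ⟨y, hy⟩ := iInter_nonempty_of_isClosed_of_convex F
    (fun j => (hcl.preimage (by fun_prop)).inter
      (isClosed_le (by fun_prop) continuous_const))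
    (fun j => (convex_setOf_sub_mem hK _).inter (convex_setOf_norm_sub_sq_le _ _))
    ⟨j₀, (Metric.isBounded_closedBall (x := g₀.2) (r := √(‖(x : Z) - g₀.1‖ ^ 2 + 1))).subset
      fun y hy => by
        rw [mem_closedBall_iff_norm]
        exact Real.le_sqrt_of_sq_le hy.2⟩
    (fun s => by
      obtain ⟨y, hy, hyi⟩ := h.exists_finite_extension hne hK (ι := s) (fun j => j.1.1.1.1)
        (fun j => j.1.1.1.2) (fun j => hG _ j.1.1.2)
        (fun i j => hG' _ i.1.1.2 _ j.1.1.2) x (fun j => j.1.2) (fun j => j.1.2.2)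
      refine ⟨y, ?_⟩
      simp only [Set.mem_iInter]
      exact fun j hj => ⟨hy, hyi ⟨j, hj⟩⟩)
  rw [Set.mem_iInter] at hy
  refine ⟨y, (hy j₀).1, fun g hg => ?_⟩
  refine le_of_sq_le_sq ?_ (norm_nonneg _)
  exact le_of_forall_pos_le_add fun ε hε => (hy (⟨g, hg⟩, ⟨ε, hε⟩)).2

/-- Zorn on graphs: the distance condition makes each member of `S` single-valued, and one-point
extension makes a maximal one total. -/
theorem ConvexCombinationCondition.convexSetExtensionCondition [CompleteSpace Y]
    (h : ConvexCombinationCondition X v) : ConvexSetExtensionCondition X v := by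
  intro K hne hcl hK A u hu huK
  let S : Set (Set (X × Y)) := {G | (∀ g ∈ G, g.2 - v g.1 ∈ K) ∧
    ∀ g ∈ G, ∀ g' ∈ G, ‖g.2 - g'.2‖ ≤ ‖(g.1 : Z) - g'.1‖}
  have hgraph : Set.range (fun a : A => ((a : X), u a)) ∈ S := by
    constructor
    · rintro _ ⟨a, rfl⟩
      exact huK a
    · rintro _ ⟨a, rfl⟩ _ ⟨b, rfl⟩
      simpa [Subtype.dist_eq, dist_eq_norm] using hu.dist_le_mul a b
  obtain ⟨G, hsub, hGS, hmax⟩ := zorn_subset_nonempty S (fun c hcS hc _ => by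
    refine ⟨⋃₀ c, ⟨?_, ?_⟩, fun s hs => Set.subset_sUnion_of_mem hs⟩
    · rintro g ⟨s, hs, hg⟩
      exact (hcS hs).1 g hg
    · rintro g ⟨s, hs, hg⟩ g' ⟨s', hs', hg'⟩
      obtain hss | hss := hc.total hs hs'
      · exact (hcS hs').2 g (hss hg) g' hg'
      · exact (hcS hs).2 g hg g' (hss hg')) _ hgraph
  have htot : ∀ x : X, ∃ y, (x, y) ∈ G := by
    intro x
    obtain ⟨y, hyK, hy⟩ := h.exists_one_point_extension hne hcl hK G hGS.1 hGS.2 x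
    refine ⟨y, hmax (y := insert (x, y) G) ⟨?_, ?_⟩ (Set.subset_insert _ _)
      (Set.mem_insert _ _)⟩
    · rintro g (rfl | hg)
      · exact hyK
      · exact hGS.1 g hg
    · rintro g (rfl | hg) g' (rfl | hg')
      · simp
      · exact hy g' hg'
      · rw [norm_sub_rev, norm_sub_rev (g.1 : Z)]
        exact hy g hg
      · exact hGS.2 g hg g' hg'
  choose u' hu' using htot
  refine ⟨u', LipschitzWith.of_dist_le_mul fun x y => ?_, fun a => ?_, fun x => hGS.1 _ (hu' x)⟩
  · simpa [Subtype.dist_eq, dist_eq_norm] using hGS.2 _ (hu' x) _ (hu' y)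
  · have := hGS.2 _ (hu' a) _ (hsub ⟨a, rfl⟩)
    simpa [sub_eq_zero] using this

theorem ConvexSetExtensionCondition.ballExtensionCondition
    (h : ConvexSetExtensionCondition X v) : BallExtensionCondition X v := by
  intro A δ hδ u hu huv
  simpa using h (Metric.closedBall 0 δ) ⟨0, by simpa⟩ Metric.isClosed_closedBall
    (convex_closedBall 0 δ) A u hu (by simpa using huv)

end Extension

/-! ### Isometric copies with one prescribed component. -/

section Embedding

variable {Z Y : Type*} [NormedAddCommGroup Z] [InnerProductSpace ℝ Z]
  [NormedAddCommGroup Y] [InnerProductSpace ℝ Y]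

lemma exists_orthonormal_inner_eq_zero {n : ℕ} (hn : ((n + 1 : ℕ) : Cardinal) ≤ Module.rank ℝ Y)
    (e : Y) : ∃ o : Fin n → Y, Orthonormal ℝ o ∧ ∀ k, inner ℝ (o k) e = 0 := by
  have hr : (n : Cardinal) ≤ Module.rank ℝ (Submodule.span ℝ {e})ᗮ := by
    have h1 := Submodule.rank_quotient_add_rank (Submodule.span ℝ {e})
    rw [(Submodule.quotientEquivOfIsCompl _ _
      (Submodule.span ℝ {e}).isCompl_orthogonal).rank_eq] at h1
    have h2 : Module.rank ℝ (Submodule.span ℝ {e}) ≤ 1 := by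
      simpa using rank_span_le (R := ℝ) ({e} : Set Y)
    have h3 : ((n + 1 : ℕ) : Cardinal) ≤ Module.rank ℝ (Submodule.span ℝ {e})ᗮ + 1 :=
      (hn.trans h1.ge).trans (by gcongr)
    rw [Nat.cast_succ] at h3
    exact Cardinal.add_one_le_add_one_iff.1 h3
  obtain ⟨b, hb⟩ := Module.le_rank_iff.1 hr
  refine ⟨fun k => ((InnerProductSpace.gramSchmidtNormed ℝ b k : (Submodule.span ℝ {e})ᗮ) : Y),
    (InnerProductSpace.gramSchmidtNormed_orthonormal hb).comp_linearIsometry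
      (Submodule.span ℝ {e})ᗮ.subtypeₗᵢ, fun k => ?_⟩
  exact Submodule.mem_orthogonal_singleton_iff_inner_left.1 (Subtype.prop _)

open scoped MatrixOrder ComplexOrder in
lemma exists_forall_sum_mul_eq_of_posSemidef {n : ℕ} {M : Matrix (Fin n) (Fin n) ℝ}
    (hM : M.PosSemidef) : ∃ B : Fin n → Fin n → ℝ, ∀ i j, ∑ k, B i k * B j k = M i j := by
  obtain ⟨B, rfl⟩ := CStarAlgebra.nonneg_iff_eq_star_mul_self.mp hM.nonneg
  exact ⟨fun i k => B k i, fun i j => by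
    simp [Matrix.star_eq_conjTranspose, Matrix.mul_apply]⟩

/-- The parts orthogonal to `e` must have as Gram matrix that of the `p i - p 0` minus a rank-one
term; `hf` says exactly that this is positive semidefinite. -/
lemma exists_norm_sub_eq_and_inner_eq {n : ℕ} (hn : ((n + 1 : ℕ) : Cardinal) ≤ Module.rank ℝ Y)
    {e : Y} (he : ‖e‖ = 1) (p : Fin (n + 1) → Z) (f : Fin (n + 1) → ℝ)
    (hf : ∀ w : Fin (n + 1) → ℝ, ∑ i, w i = 0 → |∑ i, w i * f i| ≤ ‖∑ i, w i • p i‖) :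
    ∃ a : Fin (n + 1) → Y, (∀ i j, ‖a i - a j‖ = ‖p i - p j‖) ∧ ∀ i, inner ℝ (a i) e = f i := by
  obtain ⟨o, ho, hoe⟩ := exists_orthonormal_inner_eq_zero hn e
  let g : Fin (n + 1) → Fin (n + 1) → ℝ := fun i j =>
    inner ℝ (p i - p 0) (p j - p 0) - (f i - f 0) * (f j - f 0)
  have hpos : (Matrix.of fun i j : Fin n => g i.succ j.succ).PosSemidef := by
    refine Matrix.PosSemidef.of_dotProduct_mulVec_nonneg ?_ fun x => ?_
    · ext i j
      simp [g, real_inner_comm, mul_comm]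
    · have h1 := hf (Fin.cons (-∑ i, x i) x) (by simp [Fin.sum_univ_succ])
      simp only [Fin.sum_univ_succ, Fin.cons_zero, Fin.cons_succ] at h1
      have h2 : -(∑ i, x i) * f 0 + ∑ i, x i * f i.succ = ∑ i, x i * (f i.succ - f 0) := by
        simp only [mul_sub, Finset.sum_sub_distrib, ← Finset.sum_mul]
        ring
      have h3 : -(∑ i, x i) • p 0 + ∑ i, x i • p i.succ = ∑ i, x i • (p i.succ - p 0) := by
        simp only [smul_sub, Finset.sum_sub_distrib, ← Finset.sum_smul, neg_smul]
        abel
      rw [h2, h3] at h1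
      have h4 := sq_le_sq' (neg_le_of_abs_le h1) (le_of_abs_le h1)
      rw [← real_inner_self_eq_norm_sq, sum_inner, sq, Finset.sum_mul_sum] at h4
      simp only [inner_sum, real_inner_smul_left, real_inner_smul_right] at h4
      rw [← sub_nonneg, ← Finset.sum_sub_distrib] at h4
      convert h4 using 1
      simp only [dotProduct, Matrix.mulVec, Matrix.of_apply, star_trivial, Finset.mul_sum,
        ← Finset.sum_sub_distrib, g]
      exact Finset.sum_congr rfl fun i _ => Finset.sum_congr rfl fun j _ => by ring
  obtain ⟨B, hB⟩ := exists_forall_sum_mul_eq_of_posSemidef hpos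
  let c : Fin (n + 1) → Fin n → ℝ := Fin.cons 0 B
  have hc : ∀ i j, ∑ k, c i k * c j k = g i j := by
    intro i j
    cases i using Fin.cases with
    | zero => simp [c, g]
    | succ i =>
      cases j using Fin.cases with
      | zero => simp [c, g]
      | succ j => simpa [c] using hB i j
  have hce : ∀ l : Fin n → ℝ, inner ℝ (∑ k, l k • o k) e = 0 := fun l => by
    simp [sum_inner, real_inner_smul_left, hoe]
  refine ⟨fun i => f i • e + ∑ k, c i k • o k, fun i j => ?_, fun i => ?_⟩
  · have h1 : (f i • e + ∑ k, c i k • o k) - (f j • e + ∑ k, c j k • o k) =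
        (f i - f j) • e + ∑ k, (c i k - c j k) • o k := by
      simp only [sub_smul, Finset.sum_sub_distrib]
      abel
    rw [h1, ← sq_eq_sq₀ (norm_nonneg _) (norm_nonneg _), norm_add_sq_real, real_inner_smul_left,
      real_inner_comm, hce, ← real_inner_self_eq_norm_sq (∑ k, _), ho.inner_sum, norm_smul, he]
    have h2 : ∑ k, (starRingEnd ℝ) (c i k - c j k) * (c i k - c j k) =
        g i i - 2 * g i j + g j j := by
      rw [← hc, ← hc, ← hc, Finset.mul_sum, ← Finset.sum_sub_distrib, ← Finset.sum_add_distrib]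
      exact Finset.sum_congr rfl fun k _ => by simp only [conj_trivial]; ring
    have h3 : ‖p i - p j‖ ^ 2 = ‖p i - p 0‖ ^ 2 - 2 * inner ℝ (p i - p 0) (p j - p 0)
        + ‖p j - p 0‖ ^ 2 := by
      rw [← norm_sub_sq_real, sub_sub_sub_cancel_right]
    rw [h2, h3]
    simp only [g, real_inner_self_eq_norm_sq, Real.norm_eq_abs, mul_one, sq_abs]
    ring
  · rw [inner_add_left, hce, real_inner_smul_left, real_inner_self_eq_norm_sq, he]
    ring

end Embedding

/-! ### From (iii) to (i). -/

section Converse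

variable {Z Y : Type*} [NormedAddCommGroup Z] [InnerProductSpace ℝ Z]
  [NormedAddCommGroup Y] [InnerProductSpace ℝ Y] {X : Set Z} {v : X → Y}

lemma BallExtensionCondition.inner_le (h : BallExtensionCondition X v) {ι : Type*} [Fintype ι]
    (x : X) (p : ι → X) (t : ι → ℝ) (ht0 : ∀ i, 0 ≤ t i) (ht1 : ∑ i, t i = 1) {e : Y}
    (he : ‖e‖ = 1) (a : ι → Y) (ha : ∀ i j, ‖a i - a j‖ = ‖(p i : Z) - p j‖)
    (hae : ∀ i, inner ℝ (a i) e = inner ℝ (v (p i)) e) :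
    inner ℝ (v x - ∑ i, t i • v (p i)) e ≤ ‖(x : Z) - ∑ i, t i • (p i : Z)‖ := by
  set D := ∑ i, ‖a i - v (p i)‖ ^ 2 with hD
  have hD0 : 0 ≤ D := Finset.sum_nonneg fun i _ => sq_nonneg _
  have key : ∀ s : ℝ, 0 < s → inner ℝ (v x - ∑ i, t i • v (p i)) e ≤
      ‖(x : Z) - ∑ i, t i • (p i : Z)‖ + D / (2 * s) := by
    intro s hs
    -- `p` may repeat points, but `ha` makes `a` agree on repetitions.
    choose idx hidx using fun z : Set.range p => z.2
    obtain ⟨u', hu', hext, hball⟩ := h (Set.range p) (√(s ^ 2 + D)) (Real.sqrt_nonneg _)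
      (fun z => a (idx z) - s • e)
      (LipschitzWith.of_dist_le_mul fun z z' => by
        simp [dist_eq_norm, Subtype.dist_eq, ha, hidx])
      (fun z => by
        refine Real.le_sqrt_of_sq_le ?_
        -- Orthogonality to `e` turns the squared distance into `‖a i - v (p i)‖ ^ 2 + s ^ 2`,
        -- whence the radius.
        have h1 : inner ℝ (a (idx z) - v (p (idx z))) (s • e) = 0 := by
          rw [real_inner_smul_right, inner_sub_left, hae, sub_self, mul_zero]
        have h2 : ‖a (idx z) - v (p (idx z))‖ ^ 2 ≤ D :=
          Finset.single_le_sum (f := fun i => ‖a i - v (p i)‖ ^ 2) (fun i _ => sq_nonneg _)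
            (Finset.mem_univ _)
        have h3 : a (idx z) - s • e - v z = (a (idx z) - v (p (idx z))) - s • e := by
          rw [hidx]; abel
        rw [h3, norm_sub_sq_real, h1, norm_smul, he, Real.norm_eq_abs, mul_one, sq_abs]
        linarith)
    set y := u' x + s • e with hy
    have hya : ∀ i, ‖y - a i‖ ≤ ‖(x : Z) - p i‖ := by
      intro i
      have h1 := hu'.dist_le_mul x (p i)
      have h2 := hext ⟨p i, i, rfl⟩
      have h3 : a (idx ⟨p i, i, rfl⟩) = a i := by
        rw [← sub_eq_zero, ← norm_eq_zero, ha, hidx]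
        simp
      simp only at h2
      rw [h2, h3] at h1
      simp only [dist_eq_norm, Subtype.dist_eq, NNReal.coe_one, one_mul] at h1
      rwa [← sub_add, ← add_sub_right_comm] at h1
    have hbary : ‖y - ∑ i, t i • a i‖ ≤ ‖(x : Z) - ∑ i, t i • (p i : Z)‖ := by
      refine le_of_sq_le_sq ?_ (norm_nonneg _)
      have h1 := sum_mul_norm_sub_sq t ht1 y a
      have h2 := sum_mul_norm_sub_sq t ht1 (x : Z) (fun i => (p i : Z))
      have h3 : ∑ i, t i * ‖y - a i‖ ^ 2 ≤ ∑ i, t i * ‖(x : Z) - p i‖ ^ 2 := by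
        gcongr with i
        · exact ht0 i
        · exact hya i
      simp only [ha] at h1
      linarith
    have hyv : -(D / (2 * s)) ≤ inner ℝ (y - v x) e := by
      have h1 := Real.sq_sqrt (show 0 ≤ s ^ 2 + D by positivity)
      have h2 : ‖u' x - v x‖ ^ 2 ≤ s ^ 2 + D := by
        rw [← h1]
        have := hball x
        gcongr
      have h3 : u' x - v x = (y - v x) - s • e := by rw [hy]; abel
      rw [h3, norm_sub_sq_real, real_inner_smul_right, norm_smul, he, Real.norm_eq_abs, mul_one,
        sq_abs] at h2
      rw [neg_le_iff_add_nonneg', div_add' _ _ _ (by positivity)]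
      apply div_nonneg _ (by positivity)
      nlinarith [sq_nonneg ‖y - v x‖]
    have hcs : inner ℝ (y - ∑ i, t i • a i) e ≤ ‖y - ∑ i, t i • a i‖ := by
      simpa [he] using real_inner_le_norm (y - ∑ i, t i • a i) e
    have hsum : inner ℝ (∑ i, t i • a i) e = inner ℝ (∑ i, t i • v (p i)) e := by
      simp only [sum_inner, real_inner_smul_left, hae]
    rw [inner_sub_left] at hyv hcs ⊢
    linarith
  refine le_of_forall_pos_le_add fun ε hε => (key ((D + 1) / (2 * ε)) (by positivity)).trans ?_
  gcongr
  rw [div_le_iff₀ (by positivity)]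
  field_simp
  linarith

/-- The inequality of `ConvexCombinationCondition` for combinations of exactly `m` values. -/
def ConvexCombinationBound (X : Set Z) (v : X → Y) (m : ℕ) : Prop :=
  ∀ (x : X) (p : Fin m → X) (t : Fin m → ℝ), (∀ i, 0 ≤ t i) → ∑ i, t i = 1 →
    ‖v x - ∑ i, t i • v (p i)‖ ≤ ‖(x : Z) - ∑ i, t i • (p i : Z)‖

/-- The map `v` does not increase the norm of combinations of `m` values with weights of sum
zero. -/
def ZeroSumBound (X : Set Z) (v : X → Y) (m : ℕ) : Prop :=
  ∀ (p : Fin m → X) (w : Fin m → ℝ), ∑ i, w i = 0 →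
    ‖∑ i, w i • v (p i)‖ ≤ ‖∑ i, w i • (p i : Z)‖

lemma BallExtensionCondition.convexCombinationBound (h : BallExtensionCondition X v) {n : ℕ}
    (hn : ((n + 1 : ℕ) : Cardinal) ≤ Module.rank ℝ Y) (hw : ZeroSumBound X v (n + 1)) :
    ConvexCombinationBound X v (n + 1) := by
  intro x p t ht0 ht1
  set d := v x - ∑ i, t i • v (p i) with hd
  obtain h0 | h0 := eq_or_ne d 0
  · rw [h0, norm_zero]
    exact norm_nonneg _
  have hd0 : ‖d‖ ≠ 0 := norm_ne_zero_iff.2 h0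
  have he : ‖‖d‖⁻¹ • d‖ = 1 := by
    rw [norm_smul, norm_inv, norm_norm, inv_mul_cancel₀ hd0]
  obtain ⟨a, ha, hae⟩ := exists_norm_sub_eq_and_inner_eq hn he (fun i => (p i : Z))
    (fun i => inner ℝ (v (p i)) (‖d‖⁻¹ • d)) (fun w hw0 => by
      refine le_trans ?_ (hw p w hw0)
      simpa only [sum_inner, real_inner_smul_left, he, mul_one] using
        abs_real_inner_le_norm (∑ i, w i • v (p i)) (‖d‖⁻¹ • d))
  have := h.inner_le x p t ht0 ht1 he a ha hae
  rwa [← hd, real_inner_smul_right, real_inner_self_eq_norm_mul_norm,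
    inv_mul_cancel_left₀ hd0] at this

lemma zeroSumBound_one : ZeroSumBound X v 1 := by
  intro p w hw
  simp only [Fin.sum_univ_one] at hw ⊢
  simp [hw]

lemma ConvexCombinationBound.norm_sub_le (h : ConvexCombinationBound X v 1) (x y : X) :
    ‖v x - v y‖ ≤ ‖(x : Z) - y‖ := by
  simpa using h x (fun _ => y) (fun _ => 1) (by simp) (by simp)

lemma ConvexCombinationBound.zeroSumBound_two (h : ConvexCombinationBound X v 1) :
    ZeroSumBound X v 2 := by
  intro p w hw
  rw [Fin.sum_univ_two] at hw
  obtain hw : w 1 = -w 0 := by linarith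
  simp only [Fin.sum_univ_two, hw, neg_smul, ← sub_eq_add_neg, ← smul_sub, norm_smul]
  gcongr
  exact h.norm_sub_le _ _

lemma ConvexCombinationBound.norm_smul_le (h : ConvexCombinationBound X v 2) {a b : ℝ}
    (ha : 0 ≤ a) (hb : 0 ≤ b) (x y z : X) :
    ‖a • v x + b • v y - (a + b) • v z‖ ≤ ‖a • (x : Z) + b • (y : Z) - (a + b) • (z : Z)‖ := by
  obtain h0 | h0 := (add_nonneg ha hb).eq_or_lt
  · obtain rfl : a = 0 := by linarith
    obtain rfl : b = 0 := by linarith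
    simp
  have h1 := h z ![x, y] ![a / (a + b), b / (a + b)]
    (by intro i; fin_cases i <;> simp <;> positivity)
    (by simp only [Fin.sum_univ_two, Matrix.cons_val_zero, Matrix.cons_val_one]; field_simp)
  simp only [Fin.sum_univ_two, Matrix.cons_val_zero, Matrix.cons_val_one] at h1
  have h2 := mul_le_mul_of_nonneg_left h1 h0.le
  rw [← norm_smul_of_nonneg h0.le, ← norm_smul_of_nonneg h0.le] at h2
  simp only [smul_sub, smul_add, smul_smul, mul_div_cancel₀ _ h0.ne'] at h2
  rwa [norm_sub_rev, norm_sub_rev ((a + b) • (z : Z))] at h2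

/-- Of three reals with sum zero two share a sign, so the combination is a multiple of a convex
combination of two points minus the third. Four reals can split two against two. -/
lemma ConvexCombinationBound.zeroSumBound_three (h : ConvexCombinationBound X v 2) :
    ZeroSumBound X v 3 := by
  have key : ∀ (a b c : ℝ) (x y z : X), a + b + c = 0 → 0 ≤ a * b →
      ‖a • v x + b • v y + c • v z‖ ≤ ‖a • (x : Z) + b • (y : Z) + c • (z : Z)‖ := by
    intro a b c x y z hc hab
    obtain rfl : c = -(a + b) := by linarith
    obtain ⟨ha, hb⟩ | ⟨ha, hb⟩ := mul_nonneg_iff.1 hab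
    · simpa only [neg_smul, ← sub_eq_add_neg] using h.norm_smul_le ha hb x y z
    · have := h.norm_smul_le (neg_nonneg.2 ha) (neg_nonneg.2 hb) x y z
      rw [← norm_neg, ← norm_neg (_ - _ : Z)] at this
      rwa [show -(-a • v x + -b • v y - (-a + -b) • v z) =
          a • v x + b • v y + -(a + b) • v z by module,
        show -(-a • (x : Z) + -b • (y : Z) - (-a + -b) • (z : Z)) =
          a • (x : Z) + b • (y : Z) + -(a + b) • (z : Z) by module] at this
  intro p w hw
  simp only [Fin.sum_univ_three] at hw ⊢
  have hsign : 0 ≤ w 0 * w 1 ∨ 0 ≤ w 0 * w 2 ∨ 0 ≤ w 1 * w 2 := by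
    by_contra! hneg
    obtain ⟨h1, h2, h3⟩ := hneg
    nlinarith [mul_pos_of_neg_of_neg h1 h2, mul_nonneg (sq_nonneg (w 0)) (neg_pos.2 h3).le]
  obtain hs | hs | hs := hsign
  · exact key _ _ _ _ _ _ hw hs
  · have := key _ _ (w 1) (p 0) (p 2) (p 1) (by linarith) hs
    rwa [add_right_comm, add_right_comm (w 0 • (p 0 : Z))] at this
  · have := key _ _ (w 0) (p 1) (p 2) (p 0) (by linarith) hs
    rwa [add_comm, ← add_assoc, add_comm (_ + _ : Z), ← add_assoc] at this

lemma BallExtensionCondition.convexCombinationBound_one (h : BallExtensionCondition X v)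
    (hr : ((1 : ℕ) : Cardinal) ≤ Module.rank ℝ Y) : ConvexCombinationBound X v 1 :=
  h.convexCombinationBound hr zeroSumBound_one

lemma BallExtensionCondition.convexCombinationBound_two (h : BallExtensionCondition X v)
    (hr : ((2 : ℕ) : Cardinal) ≤ Module.rank ℝ Y) : ConvexCombinationBound X v 2 :=
  h.convexCombinationBound hr
    (h.convexCombinationBound_one (le_trans (by norm_num) hr)).zeroSumBound_two

lemma BallExtensionCondition.convexCombinationBound_three (h : BallExtensionCondition X v)
    (hr : ((3 : ℕ) : Cardinal) ≤ Module.rank ℝ Y) : ConvexCombinationBound X v 3 :=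
  h.convexCombinationBound hr
    (h.convexCombinationBound_two (le_trans (by norm_num) hr)).zeroSumBound_three

/-- With `x` itself the combination of two points, `h₂` has right side zero, so `v` is affine; the
rest is the Lipschitz bound `h₁`. -/
lemma ConvexCombinationBound.of_convex (hX : Convex ℝ X) (h₁ : ConvexCombinationBound X v 1)
    (h₂ : ConvexCombinationBound X v 2) (m : ℕ) : ConvexCombinationBound X v m := by
  have hgraph : Convex ℝ (Set.range fun x : X => ((x : Z), v x)) := by
    rintro _ ⟨x, rfl⟩ _ ⟨y, rfl⟩ a b ha hb hab
    refine ⟨⟨a • (x : Z) + b • (y : Z), hX x.2 y.2 ha hb hab⟩, ?_⟩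
    have := h₂.norm_smul_le ha hb x y ⟨a • (x : Z) + b • (y : Z), hX x.2 y.2 ha hb hab⟩
    rw [hab, one_smul, one_smul, sub_self, norm_zero, norm_le_zero_iff, sub_eq_zero] at this
    simp [this]
  intro x p t ht0 ht1
  obtain ⟨z, hz⟩ := hgraph.sum_mem (fun i (_ : i ∈ Finset.univ) => ht0 i) ht1
    (fun i _ => ⟨p i, rfl⟩)
  obtain ⟨hz1, hz2⟩ := Prod.ext_iff.1 hz
  simp only [Prod.fst_sum, Prod.snd_sum, Prod.smul_mk] at hz1 hz2
  rw [← hz1, ← hz2]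
  exact h₁.norm_sub_le x z

theorem BallExtensionCondition.convexCombinationCondition (h : BallExtensionCondition X v)
    (hXY : Module.finrank ℝ Y ∈ ({1, 2, 3} : Set ℕ) ∨ Convex ℝ X) :
    ConvexCombinationCondition X v := by
  intro m hm
  match m, hm with
  | 0, _ => intro x p t _ ht1; simp at ht1
  | 1, hm => exact h.convexCombinationBound_one hm
  | 2, hm => exact h.convexCombinationBound_two hm
  | 3, hm => exact h.convexCombinationBound_three hm
  | m + 4, hm =>
    obtain hY | hX := hXY
    -- `finrank` is zero in infinite dimension, so a nonzero value forces finite dimension.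
    · have hpos : Module.finrank ℝ Y ≠ 0 ∧ Module.finrank ℝ Y ≤ 3 := by
        obtain hY | hY | hY := hY <;> rw [hY] <;> norm_num
      have : FiniteDimensional ℝ Y := Module.finite_of_finrank_pos (Nat.pos_of_ne_zero hpos.1)
      rw [← Module.finrank_eq_rank, Nat.cast_le] at hm
      omega
    · exact ConvexCombinationBound.of_convex hX
        (h.convexCombinationBound_one ((Nat.cast_le.2 (by omega)).trans hm))
        (h.convexCombinationBound_two ((Nat.cast_le.2 (by omega)).trans hm)) _

end Converse

theorem mainTheorem1 {Z Y : Type*}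
    [NormedAddCommGroup Z] [InnerProductSpace ℝ Z] [CompleteSpace Z]
    [NormedAddCommGroup Y] [InnerProductSpace ℝ Y] [CompleteSpace Y]
    (X : Set Z) (v : X → Y) :
    (ConvexCombinationCondition X v → ConvexSetExtensionCondition X v) ∧
    (ConvexSetExtensionCondition X v → BallExtensionCondition X v) ∧
    (Module.finrank ℝ Y ∈ ({1, 2, 3} : Set ℕ) ∨ Convex ℝ X →
      (BallExtensionCondition X v → ConvexCombinationCondition X v) ∧
      (ConvexCombinationCondition X v ↔ ConvexSetExtensionCondition X v) ∧
      (ConvexSetExtensionCondition X v ↔ BallExtensionCondition X v)) := by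
  have h12 : ConvexCombinationCondition X v → ConvexSetExtensionCondition X v :=
    fun h => h.convexSetExtensionCondition
  have h23 : ConvexSetExtensionCondition X v → BallExtensionCondition X v :=
    fun h => h.ballExtensionCondition
  refine ⟨h12, h23, fun hXY => ?_⟩
  have h31 : BallExtensionCondition X v → ConvexCombinationCondition X v :=
    fun h => h.convexCombinationCondition hXY
  exact ⟨h31, ⟨h12, fun h => h31 (h23 h)⟩, ⟨h23, fun h => h12 (h31 h)⟩⟩
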